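/- Let $\mathbb{F}$ be a field of characteristic $0$, let $n\ge 1$ be an integer, and let $I_n=(x_1^2,\dots,x_n^2,(x_1+\cdots+x_n)^2)\subseteq \mathbb{F}[x_1,\dots,x_n]$. Let $\mathrm{in}(I_n)$ be the initial ideal of $I_n$ with respect to the (graded) reverse lexicographic order with $x_1>x_2>\cdots>x_n$, that is, the ideal generated by the leading monomials of the nonzero elements of $I_n$. 1. $\mathrm{in}(I_n)$ is generated by $x_1^2,\dots,x_n^2$ together with, for every integer $d\ge 1$ with $2d-2\le n$, all square-free monomials of degree $d$ in the variables $x_1,\dots,x_{2d-2}$. 2. For $k\ge 1$ with $2k-2\le n$, let $D_k$ be the set of square-free monomials of degree $k$ in the variables $x_1,\dots,x_{2k-2}$ that are not divisible by any monomial of degree $k'$ in the variables $x_1,\dots,x_{2k'-2}$ for any $1\le k'<k$. Then $$\{x_1^2,\dots,x_n^2\}\cup\bigcup_{k\ge 1,\;2k-2\le n} D_k$$ is a minimal set of generators of $\mathrm{in}(I_n)$, i.e. it generates $\mathrm{in}(I_n)$ and no proper subset of it does. -/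

import Mathlib

open MvPolynomial

noncomputable section

/-- Type synonym for the exponent vectors of monomials in `n` variables, which carries the
(graded) reverse lexicographic order. -/
def DegRevLex (n : ℕ) : Type := Fin n →₀ ℕ

namespace DegRevLex

variable {n : ℕ}

instance : AddCommMonoid (DegRevLex n) := inferInstanceAs (AddCommMonoid (Fin n →₀ ℕ))

/-- The exponent vector underlying an element of `DegRevLex n`. -/
def exps (a : DegRevLex n) : Fin n →₀ ℕ := a

/-- The comparison key: first the total degree; ties are broken by the exponents read from the last
variable to the first one, compared lexicographically and in the opposite direction. -/
def key (a : DegRevLex n) : ℕ ×ₗ (Lex ((Fin n)ᵒᵈ → ℕ))ᵒᵈ :=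
  toLex (a.exps.degree, OrderDual.toDual (toLex fun i => a.exps (OrderDual.ofDual i)))

theorem key_injective : Function.Injective (key (n := n)) := by
  intro a b h
  have h1 : (ofLex (key a)).2 = (ofLex (key b)).2 := by rw [h]
  have h2 : (fun i : (Fin n)ᵒᵈ => a.exps (OrderDual.ofDual i)) =
      fun i => b.exps (OrderDual.ofDual i) := h1
  exact Finsupp.ext fun i => congrFun h2 (OrderDual.toDual i)

instance : LinearOrder (DegRevLex n) := LinearOrder.lift' key key_injective

/-- The reverse lexicographic order: `a < b` if `a` has smaller degree, or if the degrees agree and,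
at the last variable where the exponents differ, `a` has the larger exponent. -/
theorem lt_iff (a b : DegRevLex n) :
    a < b ↔ a.exps.degree < b.exps.degree ∨ (a.exps.degree = b.exps.degree ∧
      ∃ i : Fin n, (∀ j, i < j → a.exps j = b.exps j) ∧ b.exps i < a.exps i) := by
  change key a < key b ↔ _
  rw [Prod.Lex.lt_iff]
  refine or_congr Iff.rfl (and_congr Iff.rfl ?_)
  constructor
  · rintro ⟨i, h1, h2⟩
    exact ⟨OrderDual.ofDual i, fun j hj => (h1 (OrderDual.toDual j) hj).symm, h2⟩
  · rintro ⟨i, h1, h2⟩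
    exact ⟨OrderDual.toDual i, fun j hj => (h1 (OrderDual.ofDual j) hj).symm, h2⟩

theorem exps_add (a b : DegRevLex n) : (a + b).exps = a.exps + b.exps := rfl

theorem add_lt_add_left_iff (a b c : DegRevLex n) : a + c < b + c ↔ a < b := by
  simp [lt_iff, exps_add]

instance : IsOrderedAddMonoid (DegRevLex n) where
  add_le_add_left a b h c := by
    rw [← not_lt] at h ⊢
    rwa [add_lt_add_left_iff]

/-- The identity map from exponent vectors to `DegRevLex n`. -/
def toSyn : (Fin n →₀ ℕ) ≃+ DegRevLex n := AddEquiv.refl (Fin n →₀ ℕ)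

theorem toSyn_monotone : Monotone (toSyn (n := n)) := by
  intro a b h
  obtain ⟨c, rfl⟩ := exists_add_of_le h
  rw [← not_lt, lt_iff]
  change ¬ ((a + c).degree < a.degree ∨ ((a + c).degree = a.degree ∧
    ∃ i : Fin n, (∀ j, i < j → (a + c) j = a j) ∧ a i < (a + c) i))
  rw [map_add]
  rintro (h1 | ⟨h1, i, -, h2⟩)
  · omega
  · have hc : c = 0 := (Finsupp.degree_eq_zero_iff c).mp (by omega)
    simp [hc] at h2

instance : WellFoundedLT (DegRevLex n) :=
  have : WellQuasiOrderedLE (DegRevLex n) :=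
    toSyn_monotone.wellQuasiOrderedLE_of_wellQuasiOrderedLE_of_surjective toSyn.surjective
  inferInstance

end DegRevLex

/-- The (graded) reverse lexicographic monomial order on `n` variables, with
`x₁ > x₂ > ⋯ > xₙ`. -/
def revLex (n : ℕ) : MonomialOrder (Fin n) where
  syn := DegRevLex n
  toSyn := DegRevLex.toSyn
  toSyn_monotone := DegRevLex.toSyn_monotone

/-- The initial ideal of `I`: the ideal generated by the leading monomials of all nonzero
elements of `I`. -/
def initialIdeal {σ F : Type*} [Field F] (m : MonomialOrder σ) (I : Ideal (MvPolynomial σ F)) :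
    Ideal (MvPolynomial σ F) :=
  Ideal.span {p | ∃ f ∈ I, f ≠ 0 ∧ p = monomial (m.degree f) 1}

variable (F : Type*) [Field F] (n : ℕ)

/-- The set `{x₁², …, xₙ²}`. The variable `xᵢ` is `X` of the element of `Fin n` with value
`i - 1`. -/
def squares : Set (MvPolynomial (Fin n) F) := {p | ∃ i : Fin n, p = X i ^ 2}

/-- The ideal `Iₙ = (x₁², …, xₙ², (x₁ + ⋯ + xₙ)²)`. -/
def idealI : Ideal (MvPolynomial (Fin n) F) :=
  Ideal.span (squares F n ∪ {(∑ i : Fin n, X i) ^ 2})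

/-- The monomials of degree `d` in `F[x₁, …, xₙ]` that involve only the variables
`x₁, …, x_{2d-2}`. -/
def initialMonomials (d : ℕ) : Set (MvPolynomial (Fin n) F) :=
  {p | ∃ e : Fin n →₀ ℕ, e.degree = d ∧ (∀ i ∈ e.support, (i : ℕ) + 1 ≤ 2 * d - 2) ∧
    p = monomial e 1}

/-- The square-free monomials of degree `d` in `F[x₁, …, xₙ]` that involve only the variables
`x₁, …, x_{2d-2}`. -/
def squarefreeInitialMonomials (d : ℕ) : Set (MvPolynomial (Fin n) F) :=
  {p | ∃ e : Fin n →₀ ℕ, (∀ i, e i ≤ 1) ∧ e.degree = d ∧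
    (∀ i ∈ e.support, (i : ℕ) + 1 ≤ 2 * d - 2) ∧ p = monomial e 1}

/-- The set `D_k` of square-free monomials of degree `k` in `x₁, …, x_{2k-2}` that are not divisible
by any monomial of degree `k'` in `x₁, …, x_{2k'-2}` with `1 ≤ k' < k`. -/
def setD (k : ℕ) : Set (MvPolynomial (Fin n) F) :=
  {p | p ∈ squarefreeInitialMonomials F n k ∧
    ∀ k', 1 ≤ k' → k' < k → ∀ q ∈ initialMonomials F n k', ¬ q ∣ p}

end

/-!
Write `l = x₁ + ⋯ + xₙ` and `x_S` for the product of the variables in `S`. Both inclusions between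
the initial ideal and the monomial ideal have an explicit reason.

*The given monomials are leading monomials.* Let `S ⊆ {1, …, 2d-2}` have `d` elements, and let `V`
consist of `S` and all indices beyond `2d-2`. At most `d - 2` indices lie outside `V`, so the sum
`b` of their variables satisfies `b ^ (d - 1) = 0` modulo the squares. Modulo `Iₙ`, where `l ^ 2 = 0`
as well, the binomial formula gives `(∑ i ∈ V, xᵢ) ^ d = (l - b) ^ d = 0`. Modulo the squares this
power is `d!` times the elementary symmetric polynomial of degree `d` in the variables in `V`. In
characteristic zero that polynomial thus lies in `Iₙ` (`esymm_mem_idealI`), and its leading monomial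
is `x_S`.

*There are no further ones.* Suppose that `x_S` is divisible by none of the given monomials, that
is, `S` has fewer than `k` elements in `{1, …, 2k-2}` whenever `2k-2 ≤ n`. By Hall's theorem every `s ∈ S`
but the smallest one, `s₀`, has a partner `t s < s` outside `S`, with different partners for
different `s` (`exists_matching`). The substitution that fixes the variables in `S`, sends the
partner of `xₛ` to `-xₛ` and kills all other variables sends `l` to `x_{s₀}`, so it sends `Iₙ` into
the ideal of the squares, and no image of an element of `Iₙ` involves `x_S`. But a monomial whose
image involves `x_S` arises from `x_S` by replacing some `s` by the smaller `t s`, so it is at least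
`x_S` in the reverse lexicographic order. Hence an element of `Iₙ` with leading monomial `x_S` would
have an image that involves `x_S` (`degree_ne_squarefreeExp`).

Minimality holds because no monomial of the second generating set divides another one
(`isAntichain_generatorExps`, `minimal_span_eq_of_antichain`).
-/

/-! ### Powers of linear forms modulo squares -/

section SquareZero

variable {R ι : Type*} [CommRing R] [DecidableEq ι]

/-- If `x i ^ 2 = 0` for all `i`, the `d`-th power of a sum of the `x i` is `d!` times the `d`-th
elementary symmetric polynomial. -/
theorem sum_pow_eq_factorial_mul_esymm {x : ι → R} (hx : ∀ i, x i ^ 2 = 0) (V : Finset ι) (d : ℕ) :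
    (∑ i ∈ V, x i) ^ d = (d.factorial : R) * ∑ U ∈ V.powersetCard d, ∏ i ∈ U, x i := by
  induction V using Finset.induction_on generalizing d with
  | empty =>
    cases d with
    | zero => simp
    | succ d => rw [Finset.powersetCard_eq_empty.2 (by simp)]; simp
  | insert a V ha ih =>
    cases d with
    | zero => simp
    | succ d =>
      have hdisj : Disjoint (V.powersetCard (d + 1)) ((V.powersetCard d).image (insert a)) := by
        rw [Finset.disjoint_left]
        intro U hU hU'
        obtain ⟨W, -, rfl⟩ := Finset.mem_image.1 hU'
        exact ha ((Finset.mem_powersetCard.1 hU).1 (Finset.mem_insert_self a W))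
      have hinj : Set.InjOn (insert a) (V.powersetCard d : Set (Finset ι)) := by
        intro U hU W hW h
        have hU' : a ∉ U := fun h' => ha ((Finset.mem_powersetCard.1 hU).1 h')
        have hW' : a ∉ W := fun h' => ha ((Finset.mem_powersetCard.1 hW).1 h')
        rw [← Finset.erase_insert hU', ← Finset.erase_insert hW', h]
      have hprod : ∑ U ∈ V.powersetCard d, ∏ i ∈ insert a U, x i =
          x a * ∑ U ∈ V.powersetCard d, ∏ i ∈ U, x i := by
        rw [Finset.mul_sum]
        refine Finset.sum_congr rfl fun U hU => Finset.prod_insert fun h' => ?_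
        exact ha ((Finset.mem_powersetCard.1 hU).1 h')
      have hpow : ∀ y : R, (x a + y) ^ (d + 1) = y ^ (d + 1) + (d + 1) * x a * y ^ d := by
        intro y
        obtain ⟨c, hc⟩ := (Polynomial.X ^ (d + 1) : Polynomial R).binomExpansion y (x a)
        simp only [Polynomial.eval_pow, Polynomial.eval_X, Polynomial.derivative_X_pow, hx,
          mul_zero, add_zero, Polynomial.eval_mul, Polynomial.eval_C, Nat.add_sub_cancel] at hc
        rw [add_comm, hc]
        push_cast
        ring
      rw [Finset.sum_insert ha, hpow, ih, ih, Finset.powersetCard_succ_insert ha,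
        Finset.sum_union hdisj, Finset.sum_image hinj, hprod, Nat.factorial_succ]
      push_cast
      ring

/-- If `x i ^ 2 = 0` for all `i` and `(∑ i, x i) ^ 2 = 0`, the elementary symmetric polynomial of
degree `d` in the `x i`, `i ∈ V`, vanishes up to the factor `d!` as soon as fewer than `d - 1`
indices lie outside `V`. -/
theorem factorial_mul_esymm_eq_zero [Fintype ι] {x : ι → R} (hx : ∀ i, x i ^ 2 = 0)
    (hl : (∑ i, x i) ^ 2 = 0) {V : Finset ι} {d : ℕ} (hV : Vᶜ.card + 2 ≤ d) :
    (d.factorial : R) * ∑ U ∈ V.powersetCard d, ∏ i ∈ U, x i = 0 := by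
  obtain ⟨e, rfl⟩ : ∃ e, d = e + 2 := ⟨d - 2, by omega⟩
  have hb : (∑ i ∈ Vᶜ, x i) ^ (e + 1) = 0 := by
    rw [sum_pow_eq_factorial_mul_esymm hx, Finset.powersetCard_eq_empty.2 (by omega)]
    simp
  have hsum : ∑ i ∈ V, x i = -(∑ i ∈ Vᶜ, x i) + ∑ i, x i := by
    rw [← Finset.sum_add_sum_compl V x]
    ring
  rw [← sum_pow_eq_factorial_mul_esymm hx, hsum]
  obtain ⟨c, hc⟩ := (Polynomial.X ^ (e + 2) : Polynomial R).binomExpansion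
    (-(∑ i ∈ Vᶜ, x i)) (∑ i, x i)
  simp only [Polynomial.eval_pow, Polynomial.eval_X, Polynomial.derivative_X_pow, hl, mul_zero,
    add_zero, Polynomial.eval_mul, Polynomial.eval_C] at hc
  have hb' : (-(∑ i ∈ Vᶜ, x i)) ^ (e + 1) = 0 := by rw [neg_pow, hb, mul_zero]
  rw [hc, pow_succ, show e + 2 - 1 = e + 1 by omega, hb']
  ring

end SquareZero

/-! ### Monomial ideals and square-free exponents -/

/-- The exponent vector of the square-free monomial `∏ i ∈ U, X i`. -/
noncomputable def squarefreeExp {σ : Type*} (U : Finset σ) : σ →₀ ℕ := ∑ i ∈ U, Finsupp.single i 1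

theorem squarefreeExp_apply {σ : Type*} [DecidableEq σ] (U : Finset σ) (i : σ) :
    squarefreeExp U i = if i ∈ U then 1 else 0 := by
  simp [squarefreeExp, Finsupp.finsetSum_apply, Finsupp.single_apply]

theorem degree_squarefreeExp {σ : Type*} (U : Finset σ) : (squarefreeExp U).degree = U.card := by
  simp [squarefreeExp, map_sum, Finsupp.degree_single]

theorem squarefreeExp_support {σ : Type*} {e : σ →₀ ℕ} (he : ∀ i, e i ≤ 1) :
    squarefreeExp e.support = e := by
  classical
  ext i
  rw [squarefreeExp_apply]
  have := he i
  split_ifs with h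
  · have := Finsupp.mem_support_iff.1 h
    omega
  · exact (Finsupp.notMem_support_iff.1 h).symm

theorem monomial_squarefreeExp {σ R : Type*} [CommSemiring R] (U : Finset σ) :
    (monomial (squarefreeExp U) 1 : MvPolynomial σ R) = ∏ i ∈ U, X i :=
  monomial_sum_one U _

theorem squarefreeExp_le_iff {σ : Type*} {U : Finset σ} {e : σ →₀ ℕ} :
    squarefreeExp U ≤ e ↔ U ⊆ e.support := by
  classical
  refine ⟨fun h i hi => ?_, fun h i => ?_⟩
  · have := h i
    rw [squarefreeExp_apply, if_pos hi] at this
    exact Finsupp.mem_support_iff.2 (by omega)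
  · rw [squarefreeExp_apply]
    split_ifs with hi
    · exact Nat.one_le_iff_ne_zero.2 (Finsupp.mem_support_iff.1 (h hi))
    · exact Nat.zero_le _

/-- Monomials none of which divides another form a minimal generating set of the ideal that they
generate. -/
theorem minimal_span_eq_of_antichain {σ R : Type*} [CommSemiring R] [Nontrivial R]
    {E : Set (σ →₀ ℕ)} (hE : IsAntichain (· ≤ ·) E) :
    Minimal (fun S : Set (MvPolynomial σ R) =>
      Ideal.span S = Ideal.span ((fun e => monomial e (1 : R)) '' E))
      ((fun e => monomial e (1 : R)) '' E) := by
  classical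
  refine ⟨rfl, fun T hT hTE => ?_⟩
  obtain ⟨E', hE', rfl⟩ := Set.subset_image_iff.1 hTE
  rintro _ ⟨e, he, rfl⟩
  have hmem : monomial e (1 : R) ∈ Ideal.span ((fun e => monomial e (1 : R)) '' E') := by
    rw [hT]
    exact Ideal.subset_span ⟨e, he, rfl⟩
  obtain ⟨e', he', hle⟩ := mem_ideal_span_monomial_image.1 hmem e (by simp [mem_support_iff])
  rw [← hE.eq (hE' he') he hle]
  exact ⟨e', he', rfl⟩

theorem squares_eq_image (F : Type*) [Field F] (n : ℕ) :
    squares F n = (fun e => monomial e (1 : F)) '' {e | ∃ i : Fin n, e = Finsupp.single i 2} := by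
  ext p
  simp only [squares, Set.mem_ofPred_eq, Set.mem_image, X_pow_eq_monomial]
  constructor
  · rintro ⟨i, rfl⟩
    exact ⟨_, ⟨i, rfl⟩, rfl⟩
  · rintro ⟨_, ⟨i, rfl⟩, rfl⟩
    exact ⟨i, rfl⟩

theorem coeff_squarefreeExp_of_mem_span_squares {F : Type*} [Field F] {n : ℕ}
    {f : MvPolynomial (Fin n) F} (hf : f ∈ Ideal.span (squares F n)) (U : Finset (Fin n)) :
    coeff (squarefreeExp U) f = 0 := by
  rw [squares_eq_image, mem_ideal_span_monomial_image] at hf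
  by_contra h
  obtain ⟨_, ⟨i, rfl⟩, hi⟩ := hf _ (mem_support_iff.2 h)
  have := hi i
  rw [squarefreeExp_apply, Finsupp.single_eq_same] at this
  split_ifs at this <;> omega

/-! ### The reverse lexicographic order -/

theorem revLex_lt_iff {n : ℕ} (a b : Fin n →₀ ℕ) :
    (revLex n).toSyn a < (revLex n).toSyn b ↔ a.degree < b.degree ∨ (a.degree = b.degree ∧
      ∃ i : Fin n, (∀ j, i < j → a j = b j) ∧ b i < a i) :=
  DegRevLex.lt_iff a b

/-- Among the square-free monomials of a given degree whose variables lie in `S` or come after all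
variables of `S`, the largest one is the product of the variables in `S`. -/
theorem squarefreeExp_le_of_card_eq {n m : ℕ} {S U : Finset (Fin n)} (hS : ∀ i ∈ S, (i : ℕ) < m)
    (hU : ∀ i ∈ U, i ∈ S ∨ m ≤ (i : ℕ)) (hcard : U.card = S.card) :
    (revLex n).toSyn (squarefreeExp U) ≤ (revLex n).toSyn (squarefreeExp S) := by
  by_cases hUS : U ⊆ S
  · rw [Finset.eq_of_subset_of_card_le hUS hcard.ge]
  have hne : (U \ S).Nonempty := Finset.sdiff_nonempty.2 hUS
  have hmem := Finset.mem_sdiff.1 (Finset.max'_mem _ hne)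
  set u := (U \ S).max' hne with hu
  have hum : m ≤ (u : ℕ) := (hU u hmem.1).resolve_left hmem.2
  refine le_of_lt ((revLex_lt_iff _ _).2 (Or.inr ⟨?_, u, fun j hj => ?_, ?_⟩))
  · rw [degree_squarefreeExp, degree_squarefreeExp, hcard]
  · have hjS : j ∉ S := fun h => by
      have := hS j h
      have : (u : ℕ) < j := hj
      omega
    have hjU : j ∉ U := fun h =>
      absurd (Finset.le_max' _ j (Finset.mem_sdiff.2 ⟨h, hjS⟩)) (not_le.2 hj)
    rw [squarefreeExp_apply, squarefreeExp_apply, if_neg hjS, if_neg hjU]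
  · rw [squarefreeExp_apply, squarefreeExp_apply, if_neg hmem.2, if_pos hmem.1]
    exact Nat.zero_lt_one

/-! ### Monomials that are leading monomials -/

/-- The square-free monomials of degree `d` in the variables in `V` sum to an element of `Iₙ` when
`V` misses at most `d - 2` variables. -/
theorem esymm_mem_idealI (F : Type*) [Field F] [CharZero F] {n d : ℕ} {V : Finset (Fin n)}
    (hV : Vᶜ.card + 2 ≤ d) :
    ∑ U ∈ V.powersetCard d, monomial (squarefreeExp U) (1 : F) ∈ idealI F n := by
  set q := Ideal.Quotient.mk (idealI F n)
  have hx : ∀ i : Fin n, q (X i) ^ 2 = 0 := fun i => by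
    rw [← map_pow]
    exact Ideal.Quotient.eq_zero_iff_mem.2 (Ideal.subset_span (Or.inl ⟨i, rfl⟩))
  have hl : (∑ i : Fin n, q (X i)) ^ 2 = 0 := by
    rw [← map_sum, ← map_pow]
    exact Ideal.Quotient.eq_zero_iff_mem.2 (Ideal.subset_span (Or.inr rfl))
  have h := factorial_mul_esymm_eq_zero hx hl hV
  have h' : C ((d.factorial : F)) * ∑ U ∈ V.powersetCard d, monomial (squarefreeExp U) (1 : F) ∈
      idealI F n := by
    rw [← Ideal.Quotient.eq_zero_iff_mem]
    simpa [monomial_squarefreeExp, map_sum, map_prod] using h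
  have hd : (d.factorial : F) ≠ 0 := Nat.cast_ne_zero.2 d.factorial_ne_zero
  have h2 := (idealI F n).mul_mem_left (C ((d.factorial : F)⁻¹)) h'
  rwa [← mul_assoc, ← C_mul, inv_mul_cancel₀ hd, C_1, one_mul] at h2

theorem monomial_mem_initialIdeal {σ F : Type*} [Field F] (m : MonomialOrder σ)
    {I : Ideal (MvPolynomial σ F)} {f : MvPolynomial σ F} (hf : f ∈ I) {e : σ →₀ ℕ}
    (he : e ∈ f.support) (hle : ∀ c ∈ f.support, m.toSyn c ≤ m.toSyn e) :
    monomial e 1 ∈ initialIdeal m I := by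
  have hdeg : m.degree f = e :=
    m.toSyn.injective (le_antisymm (m.degree_le_iff.2 hle) (m.le_degree he))
  refine Ideal.subset_span ⟨f, hf, ?_, by rw [hdeg]⟩
  rintro rfl
  simp at he

/-- Every square-free monomial of degree `d` in the variables `x₁, …, x_{2d-2}` is a leading
monomial of `Iₙ`. -/
theorem squarefreeInitialMonomials_subset_initialIdeal (F : Type*) [Field F] [CharZero F]
    {n d : ℕ} (hd : 1 ≤ d) :
    squarefreeInitialMonomials F n d ⊆ initialIdeal (revLex n) (idealI F n) := by
  rintro _ ⟨e, he1, hed, hes, rfl⟩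
  obtain ⟨S, rfl⟩ : ∃ S : Finset (Fin n), e = squarefreeExp S :=
    ⟨_, (squarefreeExp_support he1).symm⟩
  rw [degree_squarefreeExp] at hed
  have hS : ∀ i ∈ S, (i : ℕ) < 2 * d - 2 := fun i hi => by
    have := hes i (squarefreeExp_le_iff.1 le_rfl hi)
    omega
  set V : Finset (Fin n) := Finset.univ.filter fun i => i ∈ S ∨ 2 * d - 2 ≤ (i : ℕ) with hVdef
  have hV : Vᶜ.card + 2 ≤ d := by
    have hdisj : Disjoint Vᶜ S := by
      rw [Finset.disjoint_left]
      intro i hi hiS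
      simp [hVdef, hiS] at hi
    have hsub : (Vᶜ ∪ S).image Fin.val ⊆ Finset.range (2 * d - 2) := by
      intro j hj
      obtain ⟨i, hi, rfl⟩ := Finset.mem_image.1 hj
      rw [Finset.mem_range]
      rcases Finset.mem_union.1 hi with hi | hi
      · simp [hVdef] at hi
        omega
      · exact hS i hi
    have := Finset.card_le_card hsub
    rw [Finset.card_image_of_injective _ Fin.val_injective, Finset.card_union_of_disjoint hdisj,
      Finset.card_range] at this
    -- For `d = 1` the bound says that `S` is empty, which contradicts `S.card = d`.
    omega
  have hcoeff : ∀ c : Fin n →₀ ℕ, coeff c (∑ U ∈ V.powersetCard d,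
      monomial (squarefreeExp U) (1 : F)) ≠ 0 → ∃ U ∈ V.powersetCard d, squarefreeExp U = c := by
    intro c hc
    rw [coeff_sum] at hc
    obtain ⟨U, hU, h⟩ := Finset.exists_ne_zero_of_sum_ne_zero hc
    rw [coeff_monomial] at h
    exact ⟨U, hU, by by_contra h'; exact h (if_neg h')⟩
  have hinj : ∀ U : Finset (Fin n), squarefreeExp U = squarefreeExp S → U = S := fun U h =>
    Finset.ext fun i => by
      have := DFunLike.congr_fun h i
      rw [squarefreeExp_apply, squarefreeExp_apply] at this
      split_ifs at this <;> simp_all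
  refine monomial_mem_initialIdeal _ (esymm_mem_idealI F hV) ?_ ?_
  · rw [mem_support_iff, coeff_sum, Finset.sum_eq_single S]
    · simp
    · exact fun U _ hU => by rw [coeff_monomial, if_neg fun h => hU (hinj U h)]
    · intro h
      refine absurd (Finset.mem_powersetCard.2 ⟨fun i hi => ?_, hed⟩) h
      simp [hVdef, hi]
  · intro c hc
    obtain ⟨U, hU, rfl⟩ := hcoeff c (mem_support_iff.1 hc)
    obtain ⟨hUV, hUd⟩ := Finset.mem_powersetCard.1 hU
    refine squarefreeExp_le_of_card_eq hS (fun i hi => ?_) (hUd.trans hed.symm)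
    simpa [hVdef] using hUV hi

/-! ### Monomials that are not leading monomials -/

/-- If every initial segment `x₁, …, x_{2k-2}` contains fewer than `k` of the variables in `S`, then
each element of `S` but the smallest can be matched with a smaller index outside `S`. -/
theorem exists_matching {n : ℕ} {S : Finset (Fin n)}
    (hS : ∀ k, 1 ≤ k → 2 * k - 2 ≤ n → (S.filter fun i : Fin n => (i : ℕ) + 1 ≤ 2 * k - 2).card < k)
    {s₀ : Fin n} (hs₀ : s₀ ∈ S) (hmin : ∀ s ∈ S, s₀ ≤ s) :
    ∃ t : {s // s ∈ S.erase s₀} → Fin n, Function.Injective t ∧ ∀ s, t s < s ∧ t s ∉ S := by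
  set T : {s // s ∈ S.erase s₀} → Finset (Fin n) :=
    fun s => Finset.univ.filter fun i => i < s ∧ i ∉ S with hT
  obtain ⟨t, ht, htT⟩ :=
    (Finset.all_card_le_biUnion_card_iff_exists_injective T).1 fun A => by
      rcases A.eq_empty_or_nonempty with rfl | hA
      · simp
      -- Hall's condition for `A` only involves the largest element `m` of `A`.
      obtain ⟨m, hmA, hm⟩ := A.exists_max_image (fun s => (s : Fin n)) hA
      have hmS : (m : Fin n) ∈ S := Finset.mem_of_mem_erase m.2
      have hsub : T m ⊆ A.biUnion T := Finset.subset_biUnion_of_mem T hmA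
      have hA' : A.card < (S.filter fun i => i ≤ (m : Fin n)).card := by
        have hss : A.map (Function.Embedding.subtype _) ⊂ S.filter fun i => i ≤ (m : Fin n) := by
          rw [Finset.ssubset_iff_of_subset]
          · refine ⟨s₀, Finset.mem_filter.2 ⟨hs₀, hmin _ hmS⟩, ?_⟩
            simp
          · intro i hi
            obtain ⟨s, hs, rfl⟩ := Finset.mem_map.1 hi
            exact Finset.mem_filter.2 ⟨Finset.mem_of_mem_erase s.2, hm s hs⟩
        simpa using Finset.card_lt_card hss
      have hlt : (S.filter fun i => i ≤ (m : Fin n)).card =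
          (S.filter fun i => i < (m : Fin n)).card + 1 := by
        rw [← Finset.card_insert_of_notMem (a := (m : Fin n)) (by simp)]
        congr 1
        ext i
        simp only [Finset.mem_filter, Finset.mem_insert, le_iff_eq_or_lt]
        constructor
        · rintro ⟨h1, h2 | h2⟩
          exacts [Or.inl h2, Or.inr ⟨h1, h2⟩]
        · rintro (rfl | h)
          exacts [⟨hmS, Or.inl rfl⟩, ⟨h.1, Or.inr h.2⟩]
      have hsplit : (S.filter fun i => i < (m : Fin n)).card + (T m).card = ((m : Fin n) : ℕ) := by
        rw [← Finset.card_union_of_disjoint, ← Fin.card_Iio (m : Fin n)]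
        · congr 1
          ext i
          simp only [hT, Finset.mem_union, Finset.mem_filter, Finset.mem_univ, true_and,
            Finset.mem_Iio]
          tauto
        · rw [Finset.disjoint_left]
          intro i hi hi'
          exact (Finset.mem_filter.1 hi').2.2 (Finset.mem_filter.1 hi).1
      -- The hypothesis is used for the initial segment whose length is the even one of the
      -- numbers `m` and `m + 1`.
      have hm_lt : ((m : Fin n) : ℕ) < n := (m : Fin n).2
      have hhalf : 2 * (S.filter fun i => i < (m : Fin n)).card ≤ ((m : Fin n) : ℕ) := by
        rcases Nat.even_or_odd' ((m : Fin n) : ℕ) with ⟨c, hc | hc⟩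
        · have h := hS (c + 1) (by omega) (by omega)
          have : (S.filter fun i => i < (m : Fin n)) =
              S.filter fun i : Fin n => (i : ℕ) + 1 ≤ 2 * (c + 1) - 2 := by
            refine Finset.filter_congr fun i _ => ?_
            rw [Fin.lt_def]
            omega
          rw [this]
          omega
        · have h := hS (c + 2) (by omega) (by omega)
          have : (S.filter fun i => i ≤ (m : Fin n)) =
              S.filter fun i : Fin n => (i : ℕ) + 1 ≤ 2 * (c + 2) - 2 := by
            refine Finset.filter_congr fun i _ => ?_
            rw [Fin.le_def]
            omega
          rw [← this] at h
          omega
      have := Finset.card_le_card hsub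
      omega
  exact ⟨t, ht, fun s => by simpa [hT] using htT s⟩

/-- The substitution given by a matching: the variables in `S` are fixed, the partner of `s ∈ S`
goes to `-xₛ`, and all other variables go to `0`. The images of the variables are written
`c i • x_{π i}`. -/
theorem exists_substitution (F : Type*) [Field F] {n : ℕ} {S : Finset (Fin n)}
    (hS : ∀ k, 1 ≤ k → 2 * k - 2 ≤ n →
      (S.filter fun i : Fin n => (i : ℕ) + 1 ≤ 2 * k - 2).card < k) :
    ∃ (c : Fin n → F) (π : Fin n → Fin n), (∀ i ∈ S, c i = 1 ∧ π i = i) ∧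
      (∀ i ∉ S, c i ≠ 0 → π i ∈ S ∧ i < π i) ∧
      (∑ i, C (c i) * X (π i) : MvPolynomial (Fin n) F) ^ 2 ∈ Ideal.span (squares F n) := by
  classical
  rcases S.eq_empty_or_nonempty with rfl | hne
  · exact ⟨0, id, by simp, by simp, by simp⟩
  set s₀ := S.min' hne
  have hs₀ : s₀ ∈ S := S.min'_mem hne
  obtain ⟨t, ht, hts⟩ := exists_matching hS hs₀ fun s hs => S.min'_le s hs
  set c : Fin n → F := fun i => if i ∈ S then 1 else if ∃ s, t s = i then -1 else 0 with hc
  set π : Fin n → Fin n := fun i => if h : i ∉ S ∧ ∃ s, t s = i then (h.2.choose : Fin n) else i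
    with hπ
  have hcS : ∀ i ∈ S, c i = 1 ∧ π i = i := fun i hi => by simp [hc, hπ, hi]
  have hct : ∀ s, c (t s) = -1 := fun s => by
    simp only [hc, if_neg (hts s).2, if_pos (Exists.intro s rfl : ∃ s', t s' = t s)]
  have hπt : ∀ s, π (t s) = s := fun s => by
    have h : t s ∉ S ∧ ∃ s', t s' = t s := ⟨(hts s).2, s, rfl⟩
    simp only [hπ, dif_pos h]
    exact congrArg _ (ht h.2.choose_spec)
  refine ⟨c, π, hcS, fun i hi hci => ?_, ?_⟩
  · obtain ⟨s, rfl⟩ : ∃ s, t s = i := by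
      by_contra h
      exact hci (by simp only [hc, if_neg hi, if_neg h])
    rw [hπt]
    exact ⟨Finset.mem_of_mem_erase s.2, (hts s).1⟩
  -- All terms cancel in pairs, apart from the one of the unmatched element `s₀`.
  have h1 : ∑ i ∈ S, (C (c i) * X (π i) : MvPolynomial (Fin n) F) = ∑ i ∈ S, X i :=
    Finset.sum_congr rfl fun i hi => by rw [(hcS i hi).1, (hcS i hi).2, C_1, one_mul]
  have h2 : ∑ i ∈ Sᶜ, (C (c i) * X (π i) : MvPolynomial (Fin n) F) = -∑ i ∈ S.erase s₀, X i := by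
    rw [← Finset.sum_subset (s₁ := Finset.univ.image t), Finset.sum_image (fun a _ b _ h => ht h),
      ← Finset.sum_coe_sort (S.erase s₀), ← Finset.sum_neg_distrib]
    · exact Finset.sum_congr rfl fun s _ => by rw [hct, hπt, C_neg, C_1, neg_one_mul]
    · intro i hi
      obtain ⟨s, -, rfl⟩ := Finset.mem_image.1 hi
      exact Finset.mem_compl.2 (hts s).2
    · intro i hi h
      have h' : ¬ ∃ s, t s = i := fun ⟨s, hs⟩ =>
        h (Finset.mem_image.2 ⟨s, Finset.mem_univ s, hs⟩)
      simp only [hc, if_neg (Finset.mem_compl.1 hi), if_neg h', C_0, zero_mul]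
  rw [← Finset.sum_add_sum_compl S, h1, h2, ← Finset.add_sum_erase S _ hs₀, add_neg_cancel_right]
  exact Ideal.subset_span ⟨s₀, rfl⟩

/-- A substitution as in `exists_substitution` produces the product of the variables in `S` only
from monomials that are at least as large. -/
theorem not_lt_of_coeff_substitution_ne_zero {F : Type*} [Field F] {n : ℕ} {S : Finset (Fin n)}
    {c : Fin n → F} {π : Fin n → Fin n} (hS : ∀ i ∈ S, π i = i)
    (hSc : ∀ i ∉ S, c i ≠ 0 → π i ∈ S ∧ i < π i) {e : Fin n →₀ ℕ}
    (he : coeff (squarefreeExp S) (∏ i, (C (c i) * X (π i) : MvPolynomial (Fin n) F) ^ e i) ≠ 0) :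
    ¬ (revLex n).toSyn e < (revLex n).toSyn (squarefreeExp S) := by
  classical
  have hmon : (∏ i, (C (c i) * X (π i) : MvPolynomial (Fin n) F) ^ e i) =
      monomial (∑ i, e i • Finsupp.single (π i) 1) (∏ i, c i ^ e i) := by
    rw [monomial_sum_index, map_prod, ← Finset.prod_mul_distrib]
    refine Finset.prod_congr rfl fun i _ => ?_
    rw [mul_pow, ← C_pow, X_pow_eq_monomial, Finsupp.smul_single, smul_eq_mul, mul_one]
  rw [hmon, coeff_monomial] at he
  have hexp : ∑ i, e i • Finsupp.single (π i) 1 = squarefreeExp S := by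
    by_contra h
    exact he (if_neg h)
  rw [if_pos hexp, Finset.prod_ne_zero_iff] at he
  have happ : ∀ j, ∑ i, (if π i = j then e i else 0) = if j ∈ S then 1 else 0 := fun j => by
    rw [← squarefreeExp_apply, ← hexp, Finsupp.finsetSum_apply]
    refine Finset.sum_congr rfl fun i _ => ?_
    rw [Finsupp.smul_apply, Finsupp.single_apply]
    split_ifs <;> simp
  have hdeg : e.degree = (squarefreeExp S).degree := by
    rw [← hexp, map_sum, Finsupp.degree_eq_sum]
    exact Finset.sum_congr rfl fun i _ => by
      rw [Finsupp.smul_single, Finsupp.degree_single, smul_eq_mul, mul_one]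
  rw [revLex_lt_iff]
  rintro (h | ⟨-, i, hij, hi⟩)
  · omega
  have hci : c i ≠ 0 := fun h => he i (Finset.mem_univ i) (by rw [h, zero_pow (by omega)])
  rw [squarefreeExp_apply] at hi
  by_cases hiS : i ∈ S
  · have h := happ i
    have hle : (if π i = i then e i else 0) ≤ ∑ k, (if π k = i then e k else 0) :=
      Finset.single_le_sum (f := fun k => if π k = i then e k else 0) (fun _ _ => Nat.zero_le _)
        (Finset.mem_univ i)
    rw [h, if_pos (hS i hiS), if_pos hiS] at hle
    rw [if_pos hiS] at hi
    omega
  · -- Both `i` and the later index `π i` contribute to the exponent of `π i`.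
    obtain ⟨hπ, hlt⟩ := hSc i hiS hci
    have h := happ (π i)
    have hle : ∑ k ∈ {i, π i}, (if π k = π i then e k else 0) ≤
        ∑ k, (if π k = π i then e k else 0) :=
      Finset.sum_le_univ_sum_of_nonneg fun _ => Nat.zero_le _
    rw [h, Finset.sum_pair hlt.ne, if_pos rfl, if_pos (hS _ hπ), if_pos hπ, hij _ hlt,
      squarefreeExp_apply, if_pos hπ] at hle
    rw [if_neg hiS] at hi
    omega

/-- If every initial segment `x₁, …, x_{2k-2}` contains fewer than `k` of the variables in `S`, then
the product of the variables in `S` is not a leading monomial of `Iₙ`. -/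
theorem degree_ne_squarefreeExp {F : Type*} [Field F] {n : ℕ} {S : Finset (Fin n)}
    (hS : ∀ k, 1 ≤ k → 2 * k - 2 ≤ n → (S.filter fun i : Fin n => (i : ℕ) + 1 ≤ 2 * k - 2).card < k)
    {f : MvPolynomial (Fin n) F} (hf : f ∈ idealI F n) (hf0 : f ≠ 0) :
    (revLex n).degree f ≠ squarefreeExp S := by
  intro hdeg
  obtain ⟨c, π, hcS, hSc, hsq⟩ := exists_substitution F hS
  set ψ : MvPolynomial (Fin n) F →ₐ[F] MvPolynomial (Fin n) F :=
    aeval fun i => C (c i) * X (π i) with hψ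
  have hψf : ψ f ∈ Ideal.span (squares F n) := by
    suffices h : idealI F n ≤ (Ideal.span (squares F n)).comap ψ from h hf
    refine Ideal.span_le.2 ?_
    rintro _ (⟨i, rfl⟩ | rfl)
    · simp only [SetLike.mem_coe, Ideal.mem_comap, map_pow, hψ, aeval_X, mul_pow]
      exact Ideal.mul_mem_left _ _ (Ideal.subset_span ⟨π i, rfl⟩)
    · simpa only [SetLike.mem_coe, Ideal.mem_comap, map_pow, map_sum, hψ, aeval_X] using hsq
  have hzero := coeff_squarefreeExp_of_mem_span_squares hψf S
  have hlead : coeff (squarefreeExp S) f ≠ 0 := by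
    rw [← hdeg]
    exact (revLex n).coeff_degree_ne_zero_iff.2 hf0
  have hone : (∏ i, (C (c i) * X (π i) : MvPolynomial (Fin n) F) ^ squarefreeExp S i) =
      monomial (squarefreeExp S) 1 := by
    rw [monomial_squarefreeExp, ← Finset.prod_subset (Finset.subset_univ S)]
    · refine Finset.prod_congr rfl fun i hi => ?_
      rw [squarefreeExp_apply, if_pos hi, pow_one, (hcS i hi).1, (hcS i hi).2, C_1, one_mul]
    · intro i _ hi
      rw [squarefreeExp_apply, if_neg hi, pow_zero]
  apply hlead
  rw [hψ, aeval_def, eval₂_eq', coeff_sum, Finset.sum_eq_single (squarefreeExp S)] at hzero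
  · rwa [hone, algebraMap_eq, coeff_C_mul, coeff_monomial, if_pos rfl, mul_one] at hzero
  · intro e he hne
    rw [algebraMap_eq, coeff_C_mul]
    refine mul_eq_zero_of_right _ ?_
    by_contra h
    refine not_lt_of_coeff_substitution_ne_zero (fun i hi => (hcS i hi).2) hSc h ?_
    refine lt_of_le_of_ne ?_ fun h' => hne ((revLex n).toSyn.injective h')
    rw [← hdeg]
    exact (revLex n).le_degree he
  · intro h
    exact absurd (notMem_support_iff.1 h) hlead

/-! ### The initial ideal and its minimal generators -/

theorem initialIdeal_idealI (F : Type*) [Field F] [CharZero F] (n : ℕ) :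
    initialIdeal (revLex n) (idealI F n) = Ideal.span (squares F n ∪
      {p | ∃ d : ℕ, 1 ≤ d ∧ 2 * d - 2 ≤ n ∧ p ∈ squarefreeInitialMonomials F n d}) := by
  apply le_antisymm
  · refine Ideal.span_le.2 ?_
    rintro _ ⟨f, hf, hf0, rfl⟩
    set e := (revLex n).degree f with he
    by_cases hsq : ∀ i, e i ≤ 1
    · by_cases hS : ∀ k, 1 ≤ k → 2 * k - 2 ≤ n →
          (e.support.filter fun i : Fin n => (i : ℕ) + 1 ≤ 2 * k - 2).card < k
      · exact absurd (squarefreeExp_support hsq).symm (degree_ne_squarefreeExp hS hf hf0)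
      push Not at hS
      obtain ⟨k, hk1, hkn, hk⟩ := hS
      obtain ⟨U, hU, hUk⟩ := Finset.exists_subset_card_eq hk
      have hUe : squarefreeExp U ≤ e :=
        squarefreeExp_le_iff.2 (hU.trans (Finset.filter_subset _ _))
      refine Ideal.mem_of_dvd _ (monomial_one_dvd_monomial_one.2 hUe)
        (Ideal.subset_span (Or.inr ⟨k, hk1, hkn, squarefreeExp U, fun i => (hUe i).trans (hsq i),
          by rw [degree_squarefreeExp, hUk], fun i hi => ?_, rfl⟩))
      rw [Finsupp.mem_support_iff, squarefreeExp_apply] at hi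
      have hiU : i ∈ U := by
        by_contra h
        exact hi (if_neg h)
      exact (Finset.mem_filter.1 (hU hiU)).2
    · push Not at hsq
      obtain ⟨i, hi⟩ := hsq
      have hle : Finsupp.single i 2 ≤ e := Finsupp.single_le_iff.2 hi
      refine Ideal.mem_of_dvd _ (monomial_one_dvd_monomial_one.2 hle)
        (Ideal.subset_span (Or.inl ⟨i, ?_⟩))
      rw [X_pow_eq_monomial]
  · refine Ideal.span_le.2 ?_
    rintro _ (⟨i, rfl⟩ | ⟨d, hd, -, hp⟩)
    · rw [SetLike.mem_coe, X_pow_eq_monomial]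
      refine monomial_mem_initialIdeal (revLex n) (f := monomial (Finsupp.single i 2) (1 : F)) ?_
        (by simp [mem_support_iff]) ?_
      · rw [← X_pow_eq_monomial]
        exact Ideal.subset_span (Or.inl ⟨i, rfl⟩)
      · intro c hc
        rw [Finset.mem_singleton.1 (support_monomial_subset hc)]
    · exact squarefreeInitialMonomials_subset_initialIdeal F hd hp

/-- A square-free monomial of degree `d` in `x₁, …, x_{2d-2}` is divisible by an element of some
`D_k` with `k ≤ d`. -/
theorem exists_mem_setD_dvd {F : Type*} [Field F] {n d : ℕ} (hd : 1 ≤ d)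
    {p : MvPolynomial (Fin n) F} (hp : p ∈ squarefreeInitialMonomials F n d) :
    ∃ k, 1 ≤ k ∧ k ≤ d ∧ ∃ q ∈ setD F n k, q ∣ p := by
  induction d using Nat.strong_induction_on generalizing p with
  | _ d ih =>
    by_cases hpD : p ∈ setD F n d
    · exact ⟨d, hd, le_rfl, p, hpD, dvd_rfl⟩
    have h : ¬ ∀ k', 1 ≤ k' → k' < d → ∀ q ∈ initialMonomials F n k', ¬ q ∣ p :=
      fun h => hpD ⟨hp, h⟩
    push Not at h
    obtain ⟨k', hk1, hkd, q, ⟨e', he'd, he's, rfl⟩, hqp⟩ := h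
    obtain ⟨e, he1, -, -, rfl⟩ := hp
    have hle : e' ≤ e := monomial_one_dvd_monomial_one.1 hqp
    obtain ⟨k, hk, hkk', r, hr, hrq⟩ := ih k' hkd hk1
      ⟨e', fun i => (hle i).trans (he1 i), he'd, he's, rfl⟩
    exact ⟨k, hk, hkk'.trans hkd.le, r, hr, hrq.trans hqp⟩

theorem span_squares_union_setD (F : Type*) [Field F] (n : ℕ) :
    Ideal.span (squares F n ∪ {p | ∃ k : ℕ, 1 ≤ k ∧ 2 * k - 2 ≤ n ∧ p ∈ setD F n k}) =
      Ideal.span (squares F n ∪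
        {p | ∃ d : ℕ, 1 ≤ d ∧ 2 * d - 2 ≤ n ∧ p ∈ squarefreeInitialMonomials F n d}) := by
  apply le_antisymm
  · refine Ideal.span_mono (Set.union_subset_union_right _ ?_)
    rintro p ⟨k, hk1, hkn, hp⟩
    exact ⟨k, hk1, hkn, hp.1⟩
  · refine Ideal.span_le.2 ?_
    rintro p (hp | ⟨d, hd1, hdn, hp⟩)
    · exact Ideal.subset_span (Or.inl hp)
    · obtain ⟨k, hk1, hkd, q, hq, hqp⟩ := exists_mem_setD_dvd hd1 hp
      exact Ideal.mem_of_dvd _ hqp (Ideal.subset_span (Or.inr ⟨k, hk1, by omega, hq⟩))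

/-- The exponent vectors of the squares of the variables and of the elements of all `D_k`. -/
def generatorExps (F : Type*) [Field F] (n : ℕ) : Set (Fin n →₀ ℕ) :=
  {e | ∃ i : Fin n, e = Finsupp.single i 2} ∪
    {e | ∃ k : ℕ, 1 ≤ k ∧ 2 * k - 2 ≤ n ∧ monomial e (1 : F) ∈ setD F n k}

theorem image_generatorExps (F : Type*) [Field F] (n : ℕ) :
    (fun e => monomial e (1 : F)) '' generatorExps F n =
      squares F n ∪ {p | ∃ k : ℕ, 1 ≤ k ∧ 2 * k - 2 ≤ n ∧ p ∈ setD F n k} := by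
  rw [generatorExps, Set.image_union, ← squares_eq_image]
  congr 1
  ext p
  constructor
  · rintro ⟨e, he, rfl⟩
    exact he
  · rintro ⟨k, hk1, hkn, hp⟩
    obtain ⟨e, -, -, -, rfl⟩ := hp.1
    exact ⟨e, ⟨k, hk1, hkn, hp⟩, rfl⟩

theorem isAntichain_generatorExps (F : Type*) [Field F] (n : ℕ) :
    IsAntichain (· ≤ ·) (generatorExps F n) := by
  have key : ∀ e k, monomial e (1 : F) ∈ setD F n k → (∀ i, e i ≤ 1) ∧ e.degree = k ∧
      ∀ i ∈ e.support, (i : ℕ) + 1 ≤ 2 * k - 2 := by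
    rintro e k ⟨⟨e', h1, h2, h3, h4⟩, -⟩
    obtain rfl : e = e' := monomial_left_injective one_ne_zero h4
    exact ⟨h1, h2, h3⟩
  rintro a (⟨i, rfl⟩ | ⟨k, hk1, hkn, ha⟩) b (⟨j, rfl⟩ | ⟨l, hl1, hln, hb⟩) hne hle
  · have := Finsupp.single_le_iff.1 hle
    rw [Finsupp.single_apply] at this
    split_ifs at this with h
    · exact hne (by rw [h])
    · omega
  · have := Finsupp.single_le_iff.1 hle
    have := (key b l hb).1 i
    omega
  · -- A square-free divisor of `x_j²` has degree at most one, but `D₁` is empty.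
    obtain ⟨h1, h2, h3⟩ := key a k ha
    have hs : a.support ⊆ {j} := (Finsupp.support_mono hle).trans Finsupp.support_single_subset
    have hcard : a.support.card = k := by
      rw [← degree_squarefreeExp, squarefreeExp_support h1, h2]
    have hk : k = 1 := le_antisymm (by simpa [hcard] using Finset.card_le_card hs) hk1
    obtain ⟨i, hi⟩ : a.support.Nonempty := Finset.card_pos.1 (by omega)
    have := h3 i hi
    omega
  · obtain ⟨-, h2, h3⟩ := key a k ha
    obtain ⟨-, g2, -⟩ := key b l hb
    rcases (h2 ▸ g2 ▸ Finsupp.degree_mono hle : k ≤ l).lt_or_eq with hkl | rfl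
    · exact hb.2 k hk1 hkl _ ⟨a, h2, h3, rfl⟩ (monomial_one_dvd_monomial_one.2 hle)
    · obtain ⟨c, rfl⟩ := exists_add_of_le hle
      rw [map_add] at g2
      have hc : c = 0 := (Finsupp.degree_eq_zero_iff c).1 (by omega)
      exact hne (by rw [hc, add_zero])

/-- The reverse lexicographic initial ideal of `Iₙ`, and a minimal set of generators of it. -/
theorem theorem3p1 (F : Type*) [Field F] [CharZero F] (n : ℕ) (hn : 1 ≤ n) :
    initialIdeal (revLex n) (idealI F n) =
        Ideal.span (squares F n ∪
          {p | ∃ d : ℕ, 1 ≤ d ∧ 2 * d - 2 ≤ n ∧ p ∈ squarefreeInitialMonomials F n d}) ∧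
      Minimal (fun S : Set (MvPolynomial (Fin n) F) =>
          Ideal.span S = initialIdeal (revLex n) (idealI F n))
        (squares F n ∪ {p | ∃ k : ℕ, 1 ≤ k ∧ 2 * k - 2 ≤ n ∧ p ∈ setD F n k}) := by
  refine ⟨initialIdeal_idealI F n, ?_⟩
  rw [initialIdeal_idealI, ← span_squares_union_setD, ← image_generatorExps]
  exact minimal_span_eq_of_antichain (isAntichain_generatorExps F n)
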